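/- Let $\mathcal S$ be the set of all nondegenerate closed line segments in the plane $\mathbb R^2$ (of arbitrary length) whose slope lies in the standard middle-thirds Cantor set in $[0,1]$. For $s\in\mathcal S$ and a function $f$ on $\mathbb R^2$ that is locally integrable on lines, let $\mathrm{av}_s|f|$ be the average of $|f|$ over $s$ with respect to arc length, and let $$\mathcal M f(x)=\sup_{x\in s\in\mathcal S}\mathrm{av}_s|f| .$$ Then $\mathcal M$ is unbounded on $L^p(\mathbb R^2)$ for every $0<p<\infty$. More precisely, for every such $p$ there is no finite constant $C$ such that $$\|\mathcal M f\|_{L^p(\mathbb R^2)}\le C\,\|f\|_{L^p(\mathbb R^2)}$$ holds for all continuous, compactly supported $f:\mathbb R^2\to\mathbb R$ (and hence none for all $f\in L^p(\mathbb R^2)$ that are locally integrable on lines). -/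

import Mathlib

open scoped ENNReal NNReal

namespace CantorMaximal

/-- `IsCantorSegment a b`: the line segment with endpoints `a` and `b` is nondegenerate and
non-vertical, and its slope lies in the standard middle-thirds Cantor set. -/
def IsCantorSegment (a b : ℝ × ℝ) : Prop :=
  a.1 ≠ b.1 ∧ (b.2 - a.2) / (b.1 - a.1) ∈ cantorSet

/-- The average of `|f|` over the line segment with endpoints `a` and `b`, with respect to
normalized arc length; that is the law of `(1 - t) • a + t • b` for `t` uniform in `[0, 1]`. -/
noncomputable def segmentAverage (f : ℝ × ℝ → ℝ) (a b : ℝ × ℝ) : ℝ≥0∞ :=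
  ∫⁻ t in Set.Icc (0 : ℝ) 1, ‖f (AffineMap.lineMap a b t)‖ₑ

/-- The maximal operator over all line segments whose slope is in the Cantor set: the supremum
of the averages of `|f|` over such segments (of arbitrary length) that contain `x`. -/
noncomputable def maximalOperator (f : ℝ × ℝ → ℝ) (x : ℝ × ℝ) : ℝ≥0∞ :=
  ⨆ (a : ℝ × ℝ) (b : ℝ × ℝ) (_ : IsCantorSegment a b) (_ : x ∈ segment ℝ a b),
    segmentAverage f a b

end CantorMaximal

/-!
The maximal operator is unbounded because tubes with slopes in the Cantor set can be
compressed. It is enough to find finitely many tubes with Cantor slopes over `[0, 3]` for which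
the part of their union over `[0, 1]` has measure much larger than the part over
`[2, 3]`: a continuous function of height one concentrated near the compact part over `[2, 3]` has
average at least `1 / 3` on the axis of every tube, so its maximal function is at least
`1 / 3` on the part over `[0, 1]` (`le_maximalOperator`). This argument does not depend on `p`.

The tubes come from a random sticky construction in the style of Bateman and Katz: one tube of
width `3⁻ⁿ` starts at each of the `3ⁿ` triadic intervals of `[0, 1]`, and the first `k` Cantor
digits of its slope depend only on the first `k` triadic digits of the interval
(`SlopeTree`, `tubes`). All estimates are recursions in `n` for a fixed abscissa `x`, obtained by
splitting the tree at its root, where the three branches are independent.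

* For `x ∈ [2, 3]`, whether a point is covered is a survival problem for percolation on a tree. If
  `q` is the probability of not being covered, then `g = (1 - q) / (1 + q)` is subadditive over
  branches and passes to `g / (2 + g)` along a branch, since at most one of the two digits
  is possible. By concavity its integral `I` satisfies roughly `Iₙ₊₁ ≤ Iₙ - c Iₙ²`,
  so the expected length of the section is `O(1 / n)` (`integral_conductance_vacancy_le`).
* For `x ≥ 0`, tubes from different branches meet only if they start within `x` of the boundary
  of the branches. This gives second moment at most `1 + 6 n x` for the number of tubes
  through a point (`integral_meanCountSq_le`), and the second moment method
  bounds the expected length of the section below by `1 / (1 + 6 n x)`.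

Integrating over `x ∈ [0, 1]` the latter yields `log (1 + 6 n) / (6 n)`, which beats `O(1 / n)` by a
logarithm; hence some choice of slopes has the required compression
(`exists_mul_volume_farTubes_lt`).
-/

open MeasureTheory Set
open scoped BigOperators Topology

namespace CantorMaximal

/-! ### Averages over independent choices -/

theorem expect_pi_prod {X : Type*} [Fintype X] (g : Fin 3 → X → ℝ) :
    𝔼 c : Fin 3 → X, ∏ a, g a (c a) = ∏ a, 𝔼 z, g a z := by
  simp only [Fintype.expect_eq_sum_div_card, Finset.prod_div_distrib, Finset.prod_univ_sum,
    Fintype.piFinset_univ]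
  simp

theorem expect_pi_single {X : Type*} [Fintype X] [Nonempty X] (a : Fin 3) (f : X → ℝ) :
    𝔼 c : Fin 3 → X, f (c a) = 𝔼 z, f z := by
  have h := expect_pi_prod (X := X) (fun i z => if i = a then f z else 1)
  fin_cases a <;> simpa [Fin.prod_univ_three] using h

theorem expect_pi_pair {X : Type*} [Fintype X] [Nonempty X] {a b : Fin 3} (hab : a ≠ b)
    (f g : X → ℝ) :
    𝔼 c : Fin 3 → X, f (c a) * g (c b) = (𝔼 z, f z) * 𝔼 z, g z := by
  have h := expect_pi_prod (X := X) (fun i z => if i = a then f z else if i = b then g z else 1)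
  fin_cases a <;> fin_cases b <;> first | exact absurd rfl hab | skip
  all_goals
    simp [Fin.prod_univ_three] at h
    first
    | exact h
    | simp_rw [mul_comm (f _)]
      rw [mul_comm (𝔼 z, f z)]
      exact h

theorem expect_bool_prod {X : Type*} [Fintype X] (f : Bool × X → ℝ) :
    𝔼 z, f z = ((𝔼 c, f (false, c)) + 𝔼 c, f (true, c)) / 2 := by
  rw [← Finset.univ_product_univ, Finset.expect_product]
  rw [Fintype.expect_eq_sum_div_card (ι := Bool)]
  simp [add_comm]

/-! ### Sticky families of tubes -/

/-- A choice of a Cantor digit for every edge of the ternary tree of depth `n`. A leaf of the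
tree is a triadic subinterval of `[0, 1]` of length `3⁻ⁿ`, and the digits read along the branch
leading to it (`false` for `0` and `true` for `2`) are the ternary digits of the slope of
the tube that starts at this interval. Leaves with a long common branch get nearby slopes. -/
def SlopeTree : ℕ → Type
  | 0 => Unit
  | n + 1 => Fin 3 → Bool × SlopeTree n

/-- Slope trees of a given depth form a finite type, so that one can average over them. -/
noncomputable instance SlopeTree.instFintype : (n : ℕ) → Fintype (SlopeTree n)
  | 0 => inferInstanceAs (Fintype Unit)
  | n + 1 =>
    letI := SlopeTree.instFintype n
    inferInstanceAs (Fintype (Fin 3 → Bool × SlopeTree n))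

instance SlopeTree.instNonempty : (n : ℕ) → Nonempty (SlopeTree n)
  | 0 => inferInstanceAs (Nonempty Unit)
  | n + 1 =>
    letI := SlopeTree.instNonempty n
    inferInstanceAs (Nonempty (Fin 3 → Bool × SlopeTree n))

/-- The height, in the coordinates of the `a`-th branch with first slope digit `e`, of the point
of height `y` above `x`. -/
def rescale (a : Fin 3) (e : Bool) (x y : ℝ) : ℝ :=
  3 * y - ((a : ℕ) : ℝ) - cond e (2 * x) 0

/-- The union of the tubes given by a slope tree. A tube is a (horizontally unbounded) strip of
vertical width `3⁻ⁿ` whose trace on the vertical axis is a triadic interval. -/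
def tubes : (n : ℕ) → SlopeTree n → Set (ℝ × ℝ)
  | 0, _ => {z | z.2 ∈ Icc (0 : ℝ) 1}
  | n + 1, c => ⋃ a : Fin 3, {z | (z.1, rescale a (c a).1 z.1 z.2) ∈ tubes n (c a).2}

theorem mem_tubes_succ {n : ℕ} {c : SlopeTree (n + 1)} {x y : ℝ} :
    (x, y) ∈ tubes (n + 1) c ↔ ∃ a, (x, rescale a (c a).1 x y) ∈ tubes n (c a).2 := by
  simp [tubes]

@[fun_prop]
theorem continuous_rescale (a : Fin 3) (e : Bool) :
    Continuous fun z : ℝ × ℝ => rescale a e z.1 z.2 := by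
  unfold rescale
  cases e <;> simp only [cond_true, cond_false] <;> fun_prop

theorem isClosed_tubes : ∀ (n : ℕ) (c : SlopeTree n), IsClosed (tubes n c)
  | 0, _ => isClosed_Icc.preimage continuous_snd
  | n + 1, c => by
    refine isClosed_iUnion_of_finite fun a => ?_
    exact (isClosed_tubes n (c a).2).preimage
      (continuous_fst.prodMk (continuous_rescale a (c a).1))

theorem cantorSet_digit {s : ℝ} (hs : s ∈ cantorSet) (e : Bool) :
    (s + cond e 2 0) / 3 ∈ cantorSet := by
  rw [cantorSet_eq_union_halves]
  cases e
  · left; exact ⟨s, hs, by simp⟩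
  · right; exact ⟨s, hs, by simp [add_comm]⟩

/-- Every point of the tubes lies on a full line that stays in the tubes and has
its slope in the Cantor set. -/
theorem exists_slope_of_mem_tubes : ∀ (n : ℕ) (c : SlopeTree n) {x y : ℝ}, (x, y) ∈ tubes n c →
    ∃ s ∈ cantorSet, ∀ x', (x', y + s * (x' - x)) ∈ tubes n c
  | 0, _, _, _, h => ⟨0, zero_mem_cantorSet, fun x' => by simpa [tubes] using h⟩
  | n + 1, c, x, y, h => by
    obtain ⟨a, ha⟩ := mem_tubes_succ.1 h
    obtain ⟨s, hs, hline⟩ := exists_slope_of_mem_tubes n _ ha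
    refine ⟨_, cantorSet_digit hs (c a).1, fun x' => mem_tubes_succ.2 ⟨a, ?_⟩⟩
    convert hline x' using 2
    unfold rescale
    cases (c a).1 <;> simp <;> ring

theorem mem_Icc_of_mem_tubes : ∀ (n : ℕ) (c : SlopeTree n) {x y : ℝ}, 0 ≤ x →
    (x, y) ∈ tubes n c → y ∈ Icc 0 (1 + x)
  | 0, _, x, y, hx, h => ⟨h.1, h.2.trans (by simpa using hx)⟩
  | n + 1, c, x, y, hx, h => by
    obtain ⟨a, ha⟩ := mem_tubes_succ.1 h
    obtain ⟨h0, h1⟩ := mem_Icc_of_mem_tubes n _ hx ha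
    have ha2 : ((a : ℕ) : ℝ) ≤ 2 := by exact_mod_cast Nat.lt_succ_iff.1 a.2
    have ha0 : (0 : ℝ) ≤ ((a : ℕ) : ℝ) := Nat.cast_nonneg _
    unfold rescale at h0 h1
    generalize (c a).1 = e at h0 h1
    cases e <;> simp only [cond_true, cond_false] at h0 h1 <;> constructor <;> linarith

/-! ### Integrals of rescaled functions -/

theorem integral_comp_three_mul_sub (g : ℝ → ℝ) (t : ℝ) :
    ∫ y, g (3 * y - t) = (∫ y, g y) / 3 := by
  rw [Measure.integral_comp_mul_left (fun y => g (y - t)) 3, integral_sub_right_eq_self]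
  simp [abs_of_pos, div_eq_inv_mul]

theorem _root_.MeasureTheory.Integrable.comp_three_mul_sub {g : ℝ → ℝ} (hg : Integrable g)
    (t : ℝ) : Integrable fun y => g (3 * y - t) :=
  (hg.comp_sub_right t).comp_mul_left' (R := 3) (by norm_num)

theorem integrable_of_bounded_of_support {g : ℝ → ℝ} (hg : Measurable g) {K L R : ℝ}
    (hb : ∀ y, |g y| ≤ K) (hs : ∀ y, y ∉ Icc L R → g y = 0) : Integrable g := by
  have h : Integrable ((Icc L R).indicator fun _ => K) :=
    (integrableOn_const (by simp)).integrable_indicator measurableSet_Icc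
  refine h.mono' hg.aestronglyMeasurable (Filter.Eventually.of_forall fun y => ?_)
  by_cases hy : y ∈ Icc L R
  · simpa [hy] using hb y
  · simp [hy, hs y hy]

/-! ### Far from the base the tubes overlap: the upper bound -/

/-- The probability that `(x, y)` lies in none of the tubes, for uniformly random slopes. -/
noncomputable def vacancy (n : ℕ) (x y : ℝ) : ℝ :=
  𝔼 c : SlopeTree n, (tubes n c)ᶜ.indicator (fun _ => (1 : ℝ)) (x, y)

theorem vacancy_nonneg (n : ℕ) (x y : ℝ) : 0 ≤ vacancy n x y :=
  Finset.expect_nonneg fun _ _ => indicator_nonneg (fun _ _ => zero_le_one) _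

theorem vacancy_le_one (n : ℕ) (x y : ℝ) : vacancy n x y ≤ 1 :=
  Finset.expect_le Finset.univ_nonempty fun _ _ =>
    indicator_le_self' (fun _ _ => zero_le_one) _

theorem vacancy_eq_one {n : ℕ} {x y : ℝ} (hx : 0 ≤ x) (hy : y ∉ Icc 0 (1 + x)) :
    vacancy n x y = 1 := by
  unfold vacancy
  rw [Finset.expect_congr rfl (g := fun _ => (1 : ℝ)), Fintype.expect_const]
  intro c _
  have : (x, y) ∉ tubes n c := fun h => hy (mem_Icc_of_mem_tubes n c hx h)
  simp [this]

theorem measurable_vacancy (n : ℕ) (x : ℝ) : Measurable (vacancy n x) := by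
  simp only [funext fun y => Fintype.expect_eq_sum_div_card
    (fun c : SlopeTree n => (tubes n c)ᶜ.indicator (fun _ => (1 : ℝ)) (x, y)),
    show vacancy n x = fun y => vacancy n x y from rfl, vacancy]
  refine Measurable.div_const (Finset.measurable_sum _ fun c _ => ?_) _
  exact (measurable_const.indicator (isClosed_tubes n c).measurableSet.compl).comp
    measurable_prodMk_left

/-- The three branches at the root of the tree are independent. -/
theorem vacancy_succ (n : ℕ) (x y : ℝ) :
    vacancy (n + 1) x y =
      ∏ a, (vacancy n x (rescale a false x y) + vacancy n x (rescale a true x y)) / 2 := by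
  have h (a : Fin 3) : (vacancy n x (rescale a false x y) + vacancy n x (rescale a true x y)) / 2 =
      𝔼 z : Bool × SlopeTree n,
        (tubes n z.2)ᶜ.indicator (fun _ => (1 : ℝ)) (x, rescale a z.1 x y) := by
    rw [expect_bool_prod]; rfl
  simp only [h]
  rw [← expect_pi_prod]
  refine Finset.expect_congr rfl fun c _ => ?_
  by_cases hc : (x, y) ∈ tubes (n + 1) c
  · obtain ⟨a, ha⟩ := mem_tubes_succ.1 hc
    rw [Finset.prod_eq_zero (Finset.mem_univ a) (by simp [ha])]
    simp [hc]
  · rw [Finset.prod_eq_one]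
    · simp [hc]
    · intro a _
      have : (x, rescale a (c a).1 x y) ∉ tubes n (c a).2 := fun h => hc (mem_tubes_succ.2 ⟨a, h⟩)
      simp [this]

/-- The quantity `(1 - q) / (1 + q)` attached to a vacancy probability `q`. It is comparable to
the occupation probability `1 - q`, and is the one that behaves well under branching: it is
subadditive under products, and halving the occupation probability replaces `g` by
`g / (2 + g)`, which is smaller than `g / 2`. -/
noncomputable def conductance (q : ℝ) : ℝ := (1 - q) / (1 + q)

theorem conductance_nonneg {q : ℝ} (h0 : 0 ≤ q) (h1 : q ≤ 1) : 0 ≤ conductance q :=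
  div_nonneg (by linarith) (by linarith)

theorem conductance_le_one {q : ℝ} (h0 : 0 ≤ q) : conductance q ≤ 1 := by
  unfold conductance
  rw [div_le_one (by linarith)]
  linarith

theorem one_sub_le_two_mul_conductance {q : ℝ} (h0 : 0 ≤ q) (h1 : q ≤ 1) :
    1 - q ≤ 2 * conductance q := by
  unfold conductance
  rw [← mul_div_assoc, le_div_iff₀ (by linarith)]
  nlinarith

theorem conductance_mul_le {p q : ℝ} (hp0 : 0 ≤ p) (hp1 : p ≤ 1) (hq0 : 0 ≤ q) (hq1 : q ≤ 1) :
    conductance (p * q) ≤ conductance p + conductance q := by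
  unfold conductance
  have hpq : 0 ≤ p * q := mul_nonneg hp0 hq0
  rw [div_add_div _ _ (by linarith) (by linarith), div_le_div_iff₀ (by linarith) (by positivity)]
  have h1 : 0 ≤ (1 - p) * (1 - q) := mul_nonneg (by linarith) (by linarith)
  have h2 : p * q ≤ 1 := by nlinarith
  nlinarith [mul_nonneg h1 (sub_nonneg.2 h2)]

/-- The tangent line bound for the concave function `g ↦ g / (2 + g)`. -/
theorem conductance_average_le {q : ℝ} (h0 : 0 ≤ q) (h1 : q ≤ 1) {A : ℝ} (hA : 0 ≤ A) :
    conductance ((1 + q) / 2) ≤ (A ^ 2 + 2 * conductance q) / (2 + A) ^ 2 := by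
  have hg := conductance_nonneg h0 h1
  have : conductance ((1 + q) / 2) = conductance q / (2 + conductance q) := by
    have h2 : 1 + q ≠ 0 := by linarith
    have h3 : 3 + q ≠ 0 := by linarith
    have h4 : conductance ((1 + q) / 2) = (1 - q) / (3 + q) := by
      unfold conductance
      rw [div_eq_div_iff (by linarith) h3]
      ring
    have h5 : 2 + (1 - q) / (1 + q) = (3 + q) / (1 + q) := by
      field_simp
      ring
    rw [h4, conductance, h5, div_div_div_cancel_right₀ h2]
  rw [this, div_le_div_iff₀ (by linarith) (by positivity)]
  nlinarith [sq_nonneg (A - conductance q)]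

/-- The pointwise recursive bound for the conductances. For `x ≥ 2` the two slope digits that a
branch can have put the rescaled point in disjoint intervals, so at most one of
them matters. -/
theorem conductance_vacancy_succ_le (n : ℕ) {x : ℝ} (hx : 2 ≤ x) (y : ℝ) {A : ℝ} (hA : 0 ≤ A)
    {B : ℝ → ℝ} (hB : ∀ z, B z = (Icc 0 (1 + x)).indicator (fun _ => A ^ 2 / (2 + A) ^ 2) z +
      2 / (2 + A) ^ 2 * conductance (vacancy n x z)) :
    conductance (vacancy (n + 1) x y) ≤
      ∑ a, (B (rescale a false x y) + B (rescale a true x y)) := by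
  have hB0 (z : ℝ) : 0 ≤ B z := by
    rw [hB]
    have h1 := conductance_nonneg (vacancy_nonneg n x z) (vacancy_le_one n x z)
    have h2 : 0 ≤ (Icc 0 (1 + x)).indicator (fun _ => A ^ 2 / (2 + A) ^ 2) z :=
      indicator_nonneg (fun _ _ => by positivity) _
    positivity
  have hq (z : ℝ) : conductance ((1 + vacancy n x z) / 2) ≤ B z := by
    by_cases hz : z ∈ Icc 0 (1 + x)
    · refine (conductance_average_le (vacancy_nonneg n x z) (vacancy_le_one n x z) hA).trans_eq ?_
      rw [hB, indicator_of_mem hz]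
      ring
    · rw [vacancy_eq_one (by linarith) hz]
      simpa [conductance] using hB0 z
  have hbranch (a : Fin 3) :
      conductance ((vacancy n x (rescale a false x y) + vacancy n x (rescale a true x y)) / 2) ≤
        B (rescale a false x y) + B (rescale a true x y) := by
    have hz : rescale a true x y = rescale a false x y - 2 * x := by simp [rescale]
    rw [hz]
    set z := rescale a false x y
    by_cases h : z ∈ Icc 0 (1 + x)
    · rw [vacancy_eq_one (y := z - 2 * x) (by linarith) (fun h' => by
        have := h.2; have := h'.1; linarith), add_comm (vacancy n x z)]
      linarith [hq z, hB0 (z - 2 * x)]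
    · rw [vacancy_eq_one (y := z) (by linarith) h]
      linarith [hq (z - 2 * x), hB0 z]
  rw [vacancy_succ, Fin.prod_univ_three, Fin.sum_univ_three]
  have hm (a : Fin 3) :
      0 ≤ (vacancy n x (rescale a false x y) + vacancy n x (rescale a true x y)) / 2 ∧
        (vacancy n x (rescale a false x y) + vacancy n x (rescale a true x y)) / 2 ≤ 1 := by
    have h0 (e : Bool) := vacancy_nonneg n x (rescale a e x y)
    have h1 (e : Bool) := vacancy_le_one n x (rescale a e x y)
    exact ⟨by linarith [h0 false, h0 true], by linarith [h1 false, h1 true]⟩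
  have h01 := conductance_mul_le (hm 0).1 (hm 0).2 (hm 1).1 (hm 1).2
  have h012 := conductance_mul_le (mul_nonneg (hm 0).1 (hm 1).1)
    (mul_le_one₀ (hm 0).2 (hm 1).1 (hm 1).2) (hm 2).1 (hm 2).2
  linarith [hbranch 0, hbranch 1, hbranch 2]

theorem integrable_conductance_vacancy (n : ℕ) {x : ℝ} (hx : 0 ≤ x) :
    Integrable fun y => conductance (vacancy n x y) := by
  refine integrable_of_bounded_of_support (K := 1) (L := 0) (R := 1 + x) ?_ (fun y => ?_)
    fun y hy => ?_
  · exact (measurable_const.sub (measurable_vacancy n x)).div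
      (measurable_const.add (measurable_vacancy n x))
  · rw [abs_of_nonneg (conductance_nonneg (vacancy_nonneg n x y) (vacancy_le_one n x y))]
    exact conductance_le_one (vacancy_nonneg n x y)
  · rw [vacancy_eq_one hx hy]
    simp [conductance]

theorem rescale_eq (a : Fin 3) (e : Bool) (x y : ℝ) :
    rescale a e x y = 3 * y - (((a : ℕ) : ℝ) + cond e (2 * x) 0) := by
  unfold rescale; ring

theorem integral_comp_rescale (g : ℝ → ℝ) (a : Fin 3) (e : Bool) (x : ℝ) :
    ∫ y, g (rescale a e x y) = (∫ y, g y) / 3 := by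
  simp only [rescale_eq]
  exact integral_comp_three_mul_sub g _

theorem _root_.MeasureTheory.Integrable.comp_rescale {g : ℝ → ℝ} (hg : Integrable g)
    (a : Fin 3) (e : Bool) (x : ℝ) : Integrable fun y => g (rescale a e x y) := by
  simp only [rescale_eq]
  exact hg.comp_three_mul_sub _

theorem integral_conductance_vacancy_le (n : ℕ) {x : ℝ} (hx : x ∈ Icc (2 : ℝ) 3) :
    ∫ y, conductance (vacancy n x y) ≤ 8 / (n + 1) := by
  have hx0 : 0 ≤ x := by linarith [hx.1]
  induction n with
  | zero =>
    have h (y : ℝ) : conductance (vacancy 0 x y) ≤ (Icc (0 : ℝ) 1).indicator (fun _ => 1) y := by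
      by_cases hy : y ∈ Icc (0 : ℝ) 1
      · simpa [hy] using conductance_le_one (vacancy_nonneg 0 x y)
      · have : vacancy 0 x y = 1 := by
          unfold vacancy
          rw [Finset.expect_congr rfl (g := fun _ => (1 : ℝ)), Fintype.expect_const]
          intro c _
          have : (x, y) ∉ tubes 0 c := hy
          simp [this]
        simp [this, conductance, hy]
    calc ∫ y, conductance (vacancy 0 x y)
        ≤ ∫ y, (Icc (0 : ℝ) 1).indicator (fun _ => 1) y :=
          integral_mono (integrable_conductance_vacancy 0 hx0)
            ((integrableOn_const (by simp)).integrable_indicator measurableSet_Icc) h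
      _ ≤ _ := by
          rw [integral_indicator measurableSet_Icc]
          simp
  | succ n ih =>
    -- The tangent is taken at the mean value that a conductance of integral `8 / (n + 1)`
    -- has on the interval `[0, 4]`, which contains all sections.
    set A : ℝ := 2 / (n + 1) with hA
    have hA0 : 0 ≤ A := by positivity
    set B : ℝ → ℝ := fun z => (Icc 0 (1 + x)).indicator (fun _ => A ^ 2 / (2 + A) ^ 2) z +
      2 / (2 + A) ^ 2 * conductance (vacancy n x z) with hB
    have hi1 : Integrable ((Icc 0 (1 + x)).indicator fun _ => A ^ 2 / (2 + A) ^ 2) :=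
      (integrableOn_const (by simp)).integrable_indicator measurableSet_Icc
    have hi2 := (integrable_conductance_vacancy n hx0).const_mul (2 / (2 + A) ^ 2)
    have hBi : Integrable B := hi1.add hi2
    have hBint : ∫ z, B z = ((1 + x) * A ^ 2 + 2 * ∫ y, conductance (vacancy n x y)) /
        (2 + A) ^ 2 := by
      rw [hB, integral_add hi1 hi2, integral_indicator measurableSet_Icc, integral_const_mul]
      have : (0 : ℝ) ≤ 1 + x := by linarith
      simp [this]
      ring
    have hsum : Integrable fun y => ∑ a, (B (rescale a false x y) + B (rescale a true x y)) :=
      integrable_finsetSum _ fun a _ => (hBi.comp_rescale a false x).add (hBi.comp_rescale a true x)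
    calc ∫ y, conductance (vacancy (n + 1) x y)
        ≤ ∫ y, ∑ a, (B (rescale a false x y) + B (rescale a true x y)) :=
          integral_mono (integrable_conductance_vacancy _ hx0) hsum
            fun y => conductance_vacancy_succ_le n hx.1 y hA0 fun z => rfl
      _ = 2 * ∫ z, B z := by
          have hadd (a : Fin 3) : Integrable fun y =>
              B (rescale a false x y) + B (rescale a true x y) :=
            (hBi.comp_rescale a false x).add (hBi.comp_rescale a true x)
          rw [integral_finsetSum _ fun a _ => hadd a]
          simp only [integral_add (hBi.comp_rescale _ false x) (hBi.comp_rescale _ true x),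
            integral_comp_rescale, Fin.sum_univ_three]
          ring
      _ ≤ 2 * ((4 * A ^ 2 + 2 * (8 / (n + 1))) / (2 + A) ^ 2) := by
          rw [hBint]
          have : 1 + x ≤ 4 := by linarith [hx.2]
          gcongr
      _ = 8 / ((n + 1 : ℕ) + 1) := by
          push_cast
          rw [hA]
          field_simp
          ring

/-- The expected length of a vertical section far from the base is `O(1 / n)`. -/
theorem sum_volume_section_le (n : ℕ) {x : ℝ} (hx : x ∈ Icc (2 : ℝ) 3) :
    ∑ c : SlopeTree n, volume (Prod.mk x ⁻¹' tubes n c) ≤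
      Fintype.card (SlopeTree n) * ENNReal.ofReal (16 / (n + 1)) := by
  have hx0 : 0 ≤ x := by linarith [hx.1]
  have hcard : (0 : ℝ) < Fintype.card (SlopeTree n) := by exact_mod_cast Fintype.card_pos
  have hG := integrable_conductance_vacancy n hx0
  have hmeas (c : SlopeTree n) : MeasurableSet (Prod.mk x ⁻¹' tubes n c) :=
    (isClosed_tubes n c).measurableSet.preimage measurable_prodMk_left
  calc ∑ c : SlopeTree n, volume (Prod.mk x ⁻¹' tubes n c)
      = ∫⁻ y, ∑ c : SlopeTree n, (Prod.mk x ⁻¹' tubes n c).indicator 1 y := by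
        rw [lintegral_finsetSum _ fun c _ => measurable_one.indicator (hmeas c)]
        simp only [lintegral_indicator_one (hmeas _)]
    _ ≤ ∫⁻ y, Fintype.card (SlopeTree n) *
          ENNReal.ofReal (2 * conductance (vacancy n x y)) := by
        refine lintegral_mono fun y => ?_
        have h1 := one_sub_le_two_mul_conductance (vacancy_nonneg n x y) (vacancy_le_one n x y)
        have h2 : (Fintype.card (SlopeTree n) : ℝ) * (1 - vacancy n x y) =
            ∑ c : SlopeTree n, (Prod.mk x ⁻¹' tubes n c).indicator 1 y := by
          rw [mul_sub, vacancy, Fintype.card_mul_expect, mul_one, sub_eq_iff_eq_add,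
            ← Finset.sum_add_distrib]
          have (c : SlopeTree n) : (Prod.mk x ⁻¹' tubes n c).indicator (1 : ℝ → ℝ) y +
              (tubes n c)ᶜ.indicator (fun _ => (1 : ℝ)) (x, y) = 1 := by
            by_cases h : (x, y) ∈ tubes n c <;> simp [h]
          simp [this]
        have h3 : ∑ c : SlopeTree n, (Prod.mk x ⁻¹' tubes n c).indicator (1 : ℝ → ℝ≥0∞) y =
            ENNReal.ofReal (∑ c : SlopeTree n, (Prod.mk x ⁻¹' tubes n c).indicator 1 y) := by
          rw [ENNReal.ofReal_sum_of_nonneg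
            fun c _ => indicator_nonneg (f := (1 : ℝ → ℝ)) (fun _ _ => zero_le_one) _]
          refine Finset.sum_congr rfl fun c _ => ?_
          by_cases h : (x, y) ∈ tubes n c <;> simp [h]
        simp only
        rw [h3, ← h2, ENNReal.ofReal_mul hcard.le, ENNReal.ofReal_natCast]
        gcongr
    _ = Fintype.card (SlopeTree n) * ENNReal.ofReal (2 * ∫ y, conductance (vacancy n x y)) := by
        rw [lintegral_const_mul' _ _ (by simp), ← ofReal_integral_eq_lintegral_ofReal
          (hG.const_mul 2) (Filter.Eventually.of_forall fun y => ?_), integral_const_mul]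
        exact mul_nonneg zero_le_two
          (conductance_nonneg (vacancy_nonneg n x y) (vacancy_le_one n x y))
    _ ≤ _ := by
        gcongr
        have := integral_conductance_vacancy_le n hx
        calc _ ≤ 2 * (8 / ((n : ℝ) + 1)) := by gcongr
          _ = _ := by ring

/-! ### Near the base the tubes are nearly disjoint: the lower bound -/

/-- The number of tubes through `(x, y)`. The sections of the tubes are taken half open here, so
that the sections above the same triadic interval tile exactly. -/
noncomputable def tubeCount : (n : ℕ) → SlopeTree n → ℝ → ℝ → ℝ
  | 0, _, _, y => (Ico (0 : ℝ) 1).indicator 1 y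
  | n + 1, c, x, y => ∑ a : Fin 3, tubeCount n (c a).2 x (rescale a (c a).1 x y)

theorem tubeCount_nonneg : ∀ (n : ℕ) (c : SlopeTree n) (x y : ℝ), 0 ≤ tubeCount n c x y
  | 0, _, _, _ => indicator_nonneg (fun _ _ => zero_le_one) _
  | n + 1, _, _, _ => Finset.sum_nonneg fun _ _ => tubeCount_nonneg n _ _ _

theorem tubeCount_eq_zero : ∀ (n : ℕ) (c : SlopeTree n) {x y : ℝ}, (x, y) ∉ tubes n c →
    tubeCount n c x y = 0
  | 0, _, _, _, h => indicator_of_notMem (fun h' => h (Ico_subset_Icc_self h')) _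
  | n + 1, _, _, _, h => Finset.sum_eq_zero fun a _ =>
    tubeCount_eq_zero n _ fun h' => h (mem_tubes_succ.2 ⟨a, h'⟩)

theorem tubeCount_le : ∀ (n : ℕ) (c : SlopeTree n) (x y : ℝ), tubeCount n c x y ≤ 3 ^ n
  | 0, _, _, _ => (indicator_le_self' (fun _ _ => zero_le_one) _).trans_eq (by simp)
  | n + 1, c, x, y => by
    refine (Finset.sum_le_sum fun a _ => tubeCount_le n _ _ _).trans_eq ?_
    simp [pow_succ, mul_comm]

theorem measurable_tubeCount : ∀ (n : ℕ) (c : SlopeTree n) (x : ℝ), Measurable (tubeCount n c x)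
  | 0, _, _ => measurable_one.indicator measurableSet_Ico
  | n + 1, c, x => Finset.measurable_sum _ fun a _ =>
    (measurable_tubeCount n _ x).comp (by unfold rescale; fun_prop)

theorem integrable_tubeCount (n : ℕ) (c : SlopeTree n) {x : ℝ} (hx : 0 ≤ x) :
    Integrable (tubeCount n c x) :=
  integrable_of_bounded_of_support (measurable_tubeCount n c x)
    (fun y => by simpa [abs_of_nonneg (tubeCount_nonneg n c x y)] using tubeCount_le n c x y)
    fun _ hy => tubeCount_eq_zero n c fun h => hy (mem_Icc_of_mem_tubes n c hx h)

theorem integrable_tubeCount_sq (n : ℕ) (c : SlopeTree n) {x : ℝ} (hx : 0 ≤ x) :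
    Integrable fun y => tubeCount n c x y ^ 2 :=
  integrable_of_bounded_of_support (L := 0) (R := 1 + x)
    ((measurable_tubeCount n c x).pow_const 2)
    (fun y => by
      rw [abs_of_nonneg (sq_nonneg _)]
      exact pow_le_pow_left₀ (tubeCount_nonneg n c x y) (tubeCount_le n c x y) 2)
    fun _ hy => by
      simp [tubeCount_eq_zero n c fun h => hy (mem_Icc_of_mem_tubes n c hx h)]

/-- The expected number of tubes through `(x, y)`. -/
noncomputable def meanCount (n : ℕ) (x y : ℝ) : ℝ := 𝔼 c : SlopeTree n, tubeCount n c x y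

/-- The second moment of the number of tubes through `(x, y)`. -/
noncomputable def meanCountSq (n : ℕ) (x y : ℝ) : ℝ := 𝔼 c : SlopeTree n, tubeCount n c x y ^ 2

/-- The expected number of tubes of the branch `a` through `(x, y)`. -/
noncomputable def branchMean (n : ℕ) (a : Fin 3) (x y : ℝ) : ℝ :=
  (meanCount n x (rescale a false x y) + meanCount n x (rescale a true x y)) / 2

theorem branchMean_eq_expect (n : ℕ) (a : Fin 3) (x y : ℝ) :
    branchMean n a x y =
      𝔼 z : Bool × SlopeTree n, tubeCount n z.2 x (rescale a z.1 x y) := by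
  rw [expect_bool_prod]; rfl

theorem meanCount_succ (n : ℕ) (x y : ℝ) :
    meanCount (n + 1) x y = ∑ a, branchMean n a x y := by
  have h (a : Fin 3) := expect_pi_single a
    fun z : Bool × SlopeTree n => tubeCount n z.2 x (rescale a z.1 x y)
  simp only [branchMean_eq_expect, ← h]
  exact Finset.expect_sum_comm _ _ _

theorem meanCountSq_succ (n : ℕ) (x y : ℝ) :
    meanCountSq (n + 1) x y =
      ∑ a, (meanCountSq n x (rescale a false x y) + meanCountSq n x (rescale a true x y)) / 2 +
        2 * (branchMean n 0 x y * branchMean n 1 x y + branchMean n 0 x y * branchMean n 2 x y +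
          branchMean n 1 x y * branchMean n 2 x y) := by
  set X : Fin 3 → Bool × SlopeTree n → ℝ := fun a z => tubeCount n z.2 x (rescale a z.1 x y)
  have hsq (a : Fin 3) :
      (meanCountSq n x (rescale a false x y) + meanCountSq n x (rescale a true x y)) / 2 =
        𝔼 c : Fin 3 → Bool × SlopeTree n, X a (c a) ^ 2 := by
    rw [expect_pi_single a fun z => X a z ^ 2, expect_bool_prod]; rfl
  have hpair {a b : Fin 3} (hab : a ≠ b) : branchMean n a x y * branchMean n b x y =
      𝔼 c : Fin 3 → Bool × SlopeTree n, X a (c a) * X b (c b) := by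
    rw [expect_pi_pair hab, branchMean_eq_expect, branchMean_eq_expect]
  rw [hpair (by decide : (0 : Fin 3) ≠ 1), hpair (by decide : (0 : Fin 3) ≠ 2),
    hpair (by decide : (1 : Fin 3) ≠ 2)]
  simp only [hsq]
  rw [Fin.sum_univ_three, ← Finset.expect_add_distrib, ← Finset.expect_add_distrib,
    ← Finset.expect_add_distrib, ← Finset.expect_add_distrib, Finset.mul_expect,
    ← Finset.expect_add_distrib]
  refine Finset.expect_congr rfl fun c _ => ?_
  have : tubeCount (n + 1) c x y = ∑ a, X a (c a) := rfl
  rw [this, Fin.sum_univ_three]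
  ring

theorem sum_indicator_Ico_three_mul_sub (w : ℝ) :
    ∑ a : Fin 3, (Ico (0 : ℝ) 1).indicator (1 : ℝ → ℝ) (3 * w - ((a : ℕ) : ℝ)) =
      (Ico (0 : ℝ) 1).indicator 1 w := by
  simp only [Fin.sum_univ_three, indicator_apply, mem_Ico, Pi.one_apply]
  norm_num
  split_ifs <;> first | (norm_num; done) | (exfalso; grind)

/-- The expected count is an average of indicators of translated unit intervals: at a random base
point the slope is independent of the base point. -/
theorem exists_meanCount_eq_expect (n : ℕ) (x : ℝ) :
    ∃ (ι : Type) (_ : Fintype ι) (_ : Nonempty ι) (t : ι → ℝ), ∀ y,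
      meanCount n x y = 𝔼 i, (Ico (0 : ℝ) 1).indicator 1 (y - t i) := by
  induction n with
  | zero =>
    refine ⟨Unit, inferInstance, inferInstance, fun _ => 0, fun y => ?_⟩
    have h (c : SlopeTree 0) : tubeCount 0 c x y = (Ico (0 : ℝ) 1).indicator 1 y := rfl
    simp [meanCount, h]
  | succ n ih =>
    obtain ⟨ι, _, _, t, ht⟩ := ih
    refine ⟨Bool × ι, inferInstance, inferInstance,
      fun z => (t z.2 + cond z.1 (2 * x) 0) / 3, fun y => ?_⟩
    have h (e : Bool) (i : ι) : (Ico (0 : ℝ) 1).indicator (1 : ℝ → ℝ)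
        (y - (t i + cond e (2 * x) 0) / 3) =
          ∑ a, (Ico (0 : ℝ) 1).indicator 1 (rescale a e x y - t i) := by
      rw [← sum_indicator_Ico_three_mul_sub]
      refine Finset.sum_congr rfl fun a _ => congrArg _ ?_
      unfold rescale
      ring
    rw [expect_bool_prod]
    simp only [h, meanCount_succ, branchMean, ht, Finset.expect_sum_comm]
    rw [← Finset.sum_add_distrib, Finset.sum_div]

theorem meanCount_nonneg (n : ℕ) (x y : ℝ) : 0 ≤ meanCount n x y :=
  Finset.expect_nonneg fun _ _ => tubeCount_nonneg _ _ _ _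

theorem meanCount_le_one (n : ℕ) (x y : ℝ) : meanCount n x y ≤ 1 := by
  obtain ⟨ι, _, _, t, ht⟩ := exists_meanCount_eq_expect n x
  rw [ht]
  exact Finset.expect_le Finset.univ_nonempty fun _ _ =>
    indicator_le_self' (fun _ _ => zero_le_one) _

theorem meanCount_eq_zero {n : ℕ} {x y : ℝ} (hx : 0 ≤ x) (hy : y ∉ Icc 0 (1 + x)) :
    meanCount n x y = 0 :=
  Finset.expect_eq_zero fun c _ =>
    tubeCount_eq_zero n c fun h => hy (mem_Icc_of_mem_tubes n c hx h)

theorem integrable_expect {ι : Type*} [Fintype ι] {F : ι → ℝ → ℝ} (hF : ∀ i, Integrable (F i)) :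
    Integrable fun y => 𝔼 i, F i y := by
  simp only [Fintype.expect_eq_sum_div_card]
  exact (integrable_finsetSum _ fun i _ => hF i).div_const _

theorem integral_expect {ι : Type*} [Fintype ι] {F : ι → ℝ → ℝ} (hF : ∀ i, Integrable (F i)) :
    ∫ y, 𝔼 i, F i y = 𝔼 i, ∫ y, F i y := by
  simp only [Fintype.expect_eq_sum_div_card]
  rw [integral_div, integral_finsetSum _ fun i _ => hF i]

theorem integrable_meanCount (n : ℕ) {x : ℝ} (hx : 0 ≤ x) : Integrable (meanCount n x) :=
  integrable_expect fun c => integrable_tubeCount n c hx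

theorem integrable_meanCountSq (n : ℕ) {x : ℝ} (hx : 0 ≤ x) : Integrable (meanCountSq n x) :=
  integrable_expect fun c => integrable_tubeCount_sq n c hx

theorem integrable_branchMean (n : ℕ) (a : Fin 3) {x : ℝ} (hx : 0 ≤ x) :
    Integrable (branchMean n a x) :=
  (((integrable_meanCount n hx).comp_rescale a false x).add
    ((integrable_meanCount n hx).comp_rescale a true x)).div_const 2

theorem branchMean_nonneg (n : ℕ) (a : Fin 3) (x y : ℝ) : 0 ≤ branchMean n a x y := by
  unfold branchMean
  linarith [meanCount_nonneg n x (rescale a false x y), meanCount_nonneg n x (rescale a true x y)]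

theorem branchMean_le_one (n : ℕ) (a : Fin 3) (x y : ℝ) : branchMean n a x y ≤ 1 := by
  unfold branchMean
  linarith [meanCount_le_one n x (rescale a false x y), meanCount_le_one n x (rescale a true x y)]

theorem integral_meanCount (n : ℕ) {x : ℝ} (hx : 0 ≤ x) : ∫ y, meanCount n x y = 1 := by
  induction n with
  | zero =>
    have h (y : ℝ) : meanCount 0 x y = (Ico (0 : ℝ) 1).indicator 1 y := by
      have h (c : SlopeTree 0) : tubeCount 0 c x y = (Ico (0 : ℝ) 1).indicator 1 y := rfl
      simp [meanCount, h]
    simp only [h]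
    rw [integral_indicator_one measurableSet_Ico]
    simp
  | succ n ih =>
    simp only [meanCount_succ]
    rw [integral_finsetSum _ fun a _ => integrable_branchMean n a hx]
    have hi := integrable_meanCount n hx
    simp only [branchMean, integral_div,
      integral_add (hi.comp_rescale _ false x) (hi.comp_rescale _ true x),
      integral_comp_rescale, ih, Fin.sum_univ_three]
    norm_num

/-- Tubes from different branches meet at distance `x` from the base only if they start within
distance `x` of the common boundary of the two branches. -/
theorem branchMean_mul_branchMean_le (n : ℕ) {a b : Fin 3} (hab : a < b) {x : ℝ} (hx : 0 ≤ x)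
    (y : ℝ) : branchMean n a x y * branchMean n b x y ≤
      (Icc (((b : ℕ) : ℝ) / 3) (((b : ℕ) : ℝ) / 3 + x)).indicator 1 y := by
  by_cases hy : y ∈ Icc (((b : ℕ) : ℝ) / 3) (((b : ℕ) : ℝ) / 3 + x)
  · simpa [hy] using mul_le_one₀ (branchMean_le_one n a x y) (branchMean_nonneg n b x y)
      (branchMean_le_one n b x y)
  · rw [indicator_of_notMem hy]
    have hab' : ((a : ℕ) : ℝ) + 1 ≤ ((b : ℕ) : ℝ) := by exact_mod_cast hab
    rcases lt_or_ge y (((b : ℕ) : ℝ) / 3) with h | h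
    · have : branchMean n b x y = 0 := by
        unfold branchMean rescale
        rw [meanCount_eq_zero hx, meanCount_eq_zero hx]
        · simp
        all_goals
          intro h'
          have := h'.1
          simp only [cond_true, cond_false] at this
          linarith
      simp [this]
    · have h2 : ((b : ℕ) : ℝ) / 3 + x < y := lt_of_not_ge fun h' => hy ⟨h, h'⟩
      have : branchMean n a x y = 0 := by
        unfold branchMean rescale
        rw [meanCount_eq_zero hx, meanCount_eq_zero hx]
        · simp
        all_goals
          intro h'
          have := h'.2
          simp only [cond_true, cond_false] at this
          linarith
      simp [this]

theorem integrable_branchMean_mul (n : ℕ) (a b : Fin 3) {x : ℝ} (hx : 0 ≤ x) :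
    Integrable fun y => branchMean n a x y * branchMean n b x y :=
  (integrable_branchMean n b hx).bdd_mul (c := 1)
    (integrable_branchMean n a hx).aestronglyMeasurable <|
    Filter.Eventually.of_forall fun y => by
      simpa [abs_of_nonneg (branchMean_nonneg n a x y)] using branchMean_le_one n a x y

theorem integral_branchMean_mul_le (n : ℕ) {a b : Fin 3} (hab : a < b) {x : ℝ} (hx : 0 ≤ x) :
    ∫ y, branchMean n a x y * branchMean n b x y ≤ x := by
  refine (integral_mono (integrable_branchMean_mul n a b hx) ?_
    (branchMean_mul_branchMean_le n hab hx)).trans_eq ?_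
  · exact (integrableOn_const (by simp)).integrable_indicator measurableSet_Icc
  · rw [integral_indicator_one measurableSet_Icc]
    simp [hx]

theorem integral_meanCountSq_le (n : ℕ) {x : ℝ} (hx : 0 ≤ x) :
    ∫ y, meanCountSq n x y ≤ 1 + 6 * n * x := by
  induction n with
  | zero =>
    have h (y : ℝ) : meanCountSq 0 x y = (Ico (0 : ℝ) 1).indicator 1 y := by
      have h (c : SlopeTree 0) : tubeCount 0 c x y = (Ico (0 : ℝ) 1).indicator 1 y := rfl
      by_cases hy : y ∈ Ico (0 : ℝ) 1 <;> simp [meanCountSq, h, hy]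
    simp only [h]
    rw [integral_indicator_one measurableSet_Ico]
    simp
  | succ n ih =>
    have hi := integrable_meanCountSq n hx
    have h1 (a : Fin 3) : Integrable fun y =>
        (meanCountSq n x (rescale a false x y) + meanCountSq n x (rescale a true x y)) / 2 :=
      ((hi.comp_rescale a false x).add (hi.comp_rescale a true x)).div_const 2
    have h2 := integrable_branchMean_mul n 0 1 hx
    have h3 := integrable_branchMean_mul n 0 2 hx
    have h4 := integrable_branchMean_mul n 1 2 hx
    have h23 : Integrable fun y => branchMean n 0 x y * branchMean n 1 x y +
      branchMean n 0 x y * branchMean n 2 x y := h2.add h3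
    have h234 : Integrable fun y => branchMean n 0 x y * branchMean n 1 x y +
      branchMean n 0 x y * branchMean n 2 x y +
        branchMean n 1 x y * branchMean n 2 x y := h23.add h4
    simp only [meanCountSq_succ]
    rw [integral_add (integrable_finsetSum _ fun a _ => h1 a) (h234.const_mul 2),
      integral_const_mul, integral_add h23 h4, integral_add h2 h3,
      integral_finsetSum _ fun a _ => h1 a]
    simp only [integral_div, integral_add (hi.comp_rescale _ false x) (hi.comp_rescale _ true x),
      integral_comp_rescale, Fin.sum_univ_three]
    push_cast
    linarith [integral_branchMean_mul_le n (by decide : (0 : Fin 3) < 1) hx,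
      integral_branchMean_mul_le n (by decide : (0 : Fin 3) < 2) hx,
      integral_branchMean_mul_le n (by decide : (1 : Fin 3) < 2) hx]

/-- The expected length of the vertical section at distance `x` from the base is at
least of the order of `1 / (1 + n x)`. -/
theorem le_sum_volume_section (n : ℕ) {x : ℝ} (hx : 0 ≤ x) :
    Fintype.card (SlopeTree n) * ENNReal.ofReal (1 / (1 + 6 * n * x)) ≤
      ∑ c : SlopeTree n, volume (Prod.mk x ⁻¹' tubes n c) := by
  have hmeas (c : SlopeTree n) : MeasurableSet (Prod.mk x ⁻¹' tubes n c) :=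
    (isClosed_tubes n c).measurableSet.preimage measurable_prodMk_left
  have hfin (c : SlopeTree n) : volume (Prod.mk x ⁻¹' tubes n c) ≠ ∞ :=
    ((measure_mono fun y hy => mem_Icc_of_mem_tubes n c hx hy).trans_lt
      (measure_Icc_lt_top (a := 0) (b := 1 + x))).ne
  set V : SlopeTree n → ℝ := fun c => volume.real (Prod.mk x ⁻¹' tubes n c) with hV
  -- The second moment method in linear form, from `1 ≥ 2 t N - t² N²` on the tubes, with
  -- the optimal `t = 1 / ∫ E N²`.
  set t : ℝ := 1 / (1 + 6 * n * x) with ht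
  have hD : 0 < 1 + 6 * n * x := by positivity
  have ht0 : 0 ≤ t := by positivity
  have hV_le (c : SlopeTree n) :
      2 * t * (∫ y, tubeCount n c x y) - t ^ 2 * ∫ y, tubeCount n c x y ^ 2 ≤ V c := by
    have hi1 := (integrable_tubeCount n c hx).const_mul (2 * t)
    have hi2 := (integrable_tubeCount_sq n c hx).const_mul (t ^ 2)
    rw [← integral_const_mul, ← integral_const_mul, ← integral_sub hi1 hi2, hV]
    simp only
    rw [← integral_indicator_one (hmeas c)]
    refine integral_mono (hi1.sub hi2)
      ((integrableOn_const (hfin c)).integrable_indicator (hmeas c)) fun y => ?_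
    by_cases hy : (x, y) ∈ tubes n c
    · have : (Prod.mk x ⁻¹' tubes n c).indicator (1 : ℝ → ℝ) y = 1 := by simp [hy]
      simp only [this]
      nlinarith [sq_nonneg (1 - t * tubeCount n c x y)]
    · simp [tubeCount_eq_zero n c hy, hy]
  have hEV : t ≤ 𝔼 c, V c := by
    calc t = 2 * t * 1 - t ^ 2 * (1 + 6 * n * x) := by
          rw [ht]; field_simp; ring
      _ ≤ 2 * t * (∫ y, meanCount n x y) - t ^ 2 * ∫ y, meanCountSq n x y := by
          rw [integral_meanCount n hx]
          gcongr
          exact integral_meanCountSq_le n hx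
      _ = 𝔼 c : SlopeTree n, (2 * t * (∫ y, tubeCount n c x y) -
            t ^ 2 * ∫ y, tubeCount n c x y ^ 2) := by
          unfold meanCount meanCountSq
          rw [integral_expect fun c => integrable_tubeCount n c hx,
            integral_expect fun c => integrable_tubeCount_sq n c hx, Finset.expect_sub_distrib,
            Finset.mul_expect, Finset.mul_expect]
      _ ≤ 𝔼 c, V c := Finset.expect_le_expect fun c _ => hV_le c
  calc (Fintype.card (SlopeTree n) : ℝ≥0∞) * ENNReal.ofReal t
      = ENNReal.ofReal (Fintype.card (SlopeTree n) * t) := by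
        rw [ENNReal.ofReal_mul (Nat.cast_nonneg _), ENNReal.ofReal_natCast]
    _ ≤ ENNReal.ofReal (∑ c, V c) := by
        rw [← Fintype.card_mul_expect]
        gcongr
    _ = _ := by
        rw [ENNReal.ofReal_sum_of_nonneg fun c _ => measureReal_nonneg]
        exact Finset.sum_congr rfl fun c _ => ofReal_measureReal (hfin c)

/-! ### Compression of tubes and the maximal operator -/

/-- The part of the tubes above the unit interval. -/
def nearTubes (n : ℕ) (c : SlopeTree n) : Set (ℝ × ℝ) := tubes n c ∩ Icc (0 : ℝ) 1 ×ˢ univ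

/-- The part of the tubes above the interval `[2, 3]`. -/
def farTubes (n : ℕ) (c : SlopeTree n) : Set (ℝ × ℝ) := tubes n c ∩ Icc (2 : ℝ) 3 ×ˢ univ

theorem measurableSet_nearTubes (n : ℕ) (c : SlopeTree n) : MeasurableSet (nearTubes n c) :=
  (isClosed_tubes n c).measurableSet.inter (measurableSet_Icc.prod MeasurableSet.univ)

theorem isCompact_farTubes (n : ℕ) (c : SlopeTree n) : IsCompact (farTubes n c) := by
  have hbox : IsCompact (Icc (2 : ℝ) 3 ×ˢ Icc (0 : ℝ) 4) := isCompact_Icc.prod isCompact_Icc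
  refine hbox.of_isClosed_subset
    ((isClosed_tubes n c).inter (isClosed_Icc.prod isClosed_univ)) ?_
  rintro ⟨x, y⟩ ⟨h, hx, -⟩
  have hy := mem_Icc_of_mem_tubes n c (by linarith [hx.1]) h
  exact ⟨hx, hy.1, by linarith [hy.2, hx.2]⟩

theorem volume_tubes_inter (n : ℕ) (c : SlopeTree n) (l r : ℝ) :
    volume (tubes n c ∩ Icc l r ×ˢ univ) =
      ∫⁻ x in Icc l r, volume (Prod.mk x ⁻¹' tubes n c) := by
  rw [Measure.volume_eq_prod, Measure.prod_apply
    ((isClosed_tubes n c).measurableSet.inter (measurableSet_Icc.prod MeasurableSet.univ)),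
    ← lintegral_indicator measurableSet_Icc]
  refine lintegral_congr fun x => ?_
  by_cases hx : x ∈ Icc l r
  · rw [indicator_of_mem hx]
    congr 1
    ext y
    simpa using fun _ => hx
  · rw [indicator_of_notMem hx]
    convert measure_empty (μ := (volume : Measure ℝ))
    ext y
    simpa using fun _ => not_and.1 hx

theorem measurable_volume_section (n : ℕ) (c : SlopeTree n) :
    Measurable fun x => volume (Prod.mk x ⁻¹' tubes n c) :=
  measurable_measure_prodMk_left (isClosed_tubes n c).measurableSet

theorem sum_volume_farTubes_le (n : ℕ) :
    ∑ c, volume (farTubes n c) ≤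
      Fintype.card (SlopeTree n) * ENNReal.ofReal (16 / (n + 1)) := by
  unfold farTubes
  simp only [volume_tubes_inter]
  rw [← lintegral_finsetSum _ fun c _ => measurable_volume_section n c]
  calc _ ≤ ∫⁻ x in Icc (2 : ℝ) 3, Fintype.card (SlopeTree n) * ENNReal.ofReal (16 / (n + 1)) :=
        setLIntegral_mono measurable_const fun x hx => sum_volume_section_le n hx
    _ = _ := by
        rw [setLIntegral_const, Real.volume_Icc]
        norm_num

theorem le_sum_volume_nearTubes {n : ℕ} (hn : 0 < n) :
    Fintype.card (SlopeTree n) * ENNReal.ofReal (Real.log (1 + 6 * n) / (6 * n)) ≤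
      ∑ c, volume (nearTubes n c) := by
  unfold nearTubes
  simp only [volume_tubes_inter]
  rw [← lintegral_finsetSum _ fun c _ => measurable_volume_section n c]
  have hn' : (0 : ℝ) < 6 * n := by positivity
  have hint : ∫ x in Icc (0 : ℝ) 1, 1 / (1 + 6 * n * x) = Real.log (1 + 6 * n) / (6 * n) := by
    rw [integral_Icc_eq_integral_Ioc, ← intervalIntegral.integral_of_le zero_le_one,
      intervalIntegral.integral_comp_add_mul (fun z => 1 / z) hn'.ne' 1,
      integral_one_div_of_pos (by norm_num) (by linarith)]
    simp [div_eq_inv_mul]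
  have hcont : ContinuousOn (fun x : ℝ => 1 / (1 + 6 * n * x)) (Icc 0 1) := by
    refine continuousOn_const.div (by fun_prop) fun x hx => ?_
    have := mul_nonneg hn'.le hx.1
    positivity
  calc _ = ∫⁻ x in Icc (0 : ℝ) 1,
          Fintype.card (SlopeTree n) * ENNReal.ofReal (1 / (1 + 6 * n * x)) := by
        rw [lintegral_const_mul' _ _ (by simp), ← hint, ofReal_integral_eq_lintegral_ofReal
          hcont.integrableOn_Icc]
        filter_upwards [ae_restrict_mem measurableSet_Icc] with x hx
        have := mul_nonneg hn'.le hx.1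
        simp only [Pi.zero_apply]
        positivity
    _ ≤ _ := setLIntegral_mono
        (Finset.measurable_sum _ fun c _ => measurable_volume_section n c)
        fun x hx => le_sum_volume_section n hx.1

/-- Some sticky choice of slopes compresses the tubes by an arbitrarily large factor. -/
theorem exists_mul_volume_farTubes_lt (K : ℝ≥0) :
    ∃ (n : ℕ) (c : SlopeTree n), K * volume (farTubes n c) < volume (nearTubes n c) := by
  obtain ⟨n, hn, hlog⟩ : ∃ n : ℕ, 0 < n ∧ 96 * (K : ℝ) < Real.log (1 + 6 * n) := by
    have h : Filter.Tendsto (fun n : ℕ => Real.log (1 + 6 * n)) Filter.atTop Filter.atTop :=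
      Real.tendsto_log_atTop.comp (Filter.tendsto_atTop_add_const_left _ _
        (tendsto_natCast_atTop_atTop.const_mul_atTop (by norm_num)))
    exact ((Filter.eventually_gt_atTop 0).and (h.eventually_gt_atTop _)).exists
  refine ⟨n, ?_⟩
  have hlt : (K : ℝ) * (16 / (n + 1)) < Real.log (1 + 6 * n) / (6 * n) := by
    have hn' : (0 : ℝ) < n := by exact_mod_cast hn
    rw [lt_div_iff₀ (by positivity)]
    refine lt_of_le_of_lt ?_ hlog
    rw [mul_div_assoc', div_mul_eq_mul_div, div_le_iff₀ (by positivity)]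
    nlinarith [K.2]
  have hsum : ∑ c, K * volume (farTubes n c) < ∑ c, volume (nearTubes n c) := by
    rw [← Finset.mul_sum]
    calc K * ∑ c, volume (farTubes n c)
        ≤ K * (Fintype.card (SlopeTree n) * ENNReal.ofReal (16 / (n + 1))) := by
          gcongr
          exact sum_volume_farTubes_le n
      _ = Fintype.card (SlopeTree n) * ENNReal.ofReal (K * (16 / (n + 1))) := by
          rw [ENNReal.ofReal_mul K.coe_nonneg, ENNReal.ofReal_coe_nnreal]
          ring
      _ < Fintype.card (SlopeTree n) * ENNReal.ofReal (Real.log (1 + 6 * n) / (6 * n)) := by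
          refine ENNReal.mul_lt_mul_right (by simp) (by simp) ?_
          refine (ENNReal.ofReal_lt_ofReal_iff (lt_of_le_of_lt ?_ hlt)).2 hlt
          positivity
      _ ≤ _ := le_sum_volume_nearTubes hn
  obtain ⟨c, -, hc⟩ := Finset.exists_lt_of_sum_lt hsum
  exact ⟨c, hc⟩

/-- A point above `[0, 1]` lies on a segment over `[0, 3]` inside its tube, and a third of that
segment lies above `[2, 3]`. -/
theorem le_maximalOperator {n : ℕ} {c : SlopeTree n} {f : ℝ × ℝ → ℝ}
    (hf : ∀ z ∈ farTubes n c, f z = 1) {z : ℝ × ℝ} (hz : z ∈ nearTubes n c) :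
    3⁻¹ ≤ maximalOperator f z := by
  obtain ⟨x, y⟩ := z
  obtain ⟨hxy, hx, -⟩ := hz
  replace hx : x ∈ Icc (0 : ℝ) 1 := hx
  obtain ⟨s, hs, hline⟩ := exists_slope_of_mem_tubes n c hxy
  have hmap (t : ℝ) : AffineMap.lineMap ((0, y - s * x) : ℝ × ℝ) (3, y + s * (3 - x)) t =
      (3 * t, y + s * (3 * t - x)) := by
    ext
    · simp [AffineMap.lineMap_apply, mul_comm]
    · simp [AffineMap.lineMap_apply]
      ring
  have hseg : IsCantorSegment ((0, y - s * x) : ℝ × ℝ) (3, y + s * (3 - x)) := by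
    refine ⟨by norm_num, ?_⟩
    convert hs using 1
    simp only
    ring
  have hmem : (x, y) ∈ segment ℝ ((0, y - s * x) : ℝ × ℝ) (3, y + s * (3 - x)) := by
    rw [segment_eq_image_lineMap]
    refine ⟨x / 3, ⟨by linarith [hx.1], by linarith [hx.2]⟩, ?_⟩
    rw [hmap]
    ext <;> simp only <;> ring
  refine le_trans ?_ (le_iSup_of_le _ (le_iSup_of_le _ (le_iSup_of_le hseg
    (le_iSup_of_le hmem le_rfl))))
  unfold segmentAverage
  calc (3⁻¹ : ℝ≥0∞) = ∫⁻ t in Icc (2 / 3 : ℝ) 1, 1 := by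
        rw [setLIntegral_const, Real.volume_Icc, one_mul]
        norm_num
        rw [ENNReal.ofReal_div_of_pos (by norm_num)]
        simp
    _ ≤ ∫⁻ t in Icc (2 / 3 : ℝ) 1, ‖f (AffineMap.lineMap ((0, y - s * x) : ℝ × ℝ)
          (3, y + s * (3 - x)) t)‖ₑ := by
        refine setLIntegral_mono' measurableSet_Icc fun t ht => ?_
        rw [hmap, hf]
        · simp
        · exact ⟨hline _, ⟨by linarith [ht.1], by linarith [ht.2]⟩, trivial⟩
    _ ≤ _ := lintegral_mono_set (Icc_subset_Icc (by norm_num) le_rfl)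

end CantorMaximal

/-- The maximal operator over segments with slopes in the Cantor set is unbounded on `L^p(ℝ²)` for
every finite `p`: no strong-type bound holds, even if it is only asked of continuous compactly
supported functions (which are in `L^p` and locally integrable on every line). -/
theorem corollary0p2 (p : ℝ≥0∞) (hp_pos : p ≠ 0) (hp_fin : p ≠ ∞) :
    ¬ ∃ C : ℝ≥0, ∀ f : ℝ × ℝ → ℝ, Continuous f → HasCompactSupport f →
      MeasureTheory.eLpNorm (CantorMaximal.maximalOperator f) p MeasureTheory.volume ≤
        C * MeasureTheory.eLpNorm f p MeasureTheory.volume := by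
  rintro ⟨C, hC⟩
  have hp : 0 < p.toReal := ENNReal.toReal_pos hp_pos hp_fin
  set K : ℝ≥0 := (3 * C) ^ p.toReal
  obtain ⟨n, c, hc⟩ := CantorMaximal.exists_mul_volume_farTubes_lt K
  -- An open set slightly larger than the far part still has small measure.
  obtain ⟨U, hFU, hU, hlt⟩ : ∃ U, CantorMaximal.farTubes n c ⊆ U ∧ IsOpen U ∧
      K * volume U < volume (CantorMaximal.nearTubes n c) := by
    rcases eq_or_ne K 0 with h0 | h0
    · refine ⟨univ, subset_univ _, isOpen_univ, ?_⟩
      rw [h0] at hc ⊢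
      simpa using hc
    · have h0' : (K : ℝ≥0∞) ≠ 0 := by exact_mod_cast h0
      rw [mul_comm, ← ENNReal.lt_div_iff_mul_lt (Or.inl h0') (Or.inl ENNReal.coe_ne_top)] at hc
      obtain ⟨U, hFU, hU, hlt⟩ := Set.exists_isOpen_lt_of_lt _ _ hc
      refine ⟨U, hFU, hU, ?_⟩
      rwa [ENNReal.lt_div_iff_mul_lt (Or.inl h0') (Or.inl ENNReal.coe_ne_top), mul_comm] at hlt
  obtain ⟨f, hf1, hf0, hfc, hf01⟩ := exists_continuous_one_zero_of_isCompact
    (CantorMaximal.isCompact_farTubes n c) hU.isClosed_compl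
    (disjoint_compl_right_iff_subset.2 hFU)
  have hlow : (3⁻¹ : ℝ≥0∞) * volume (CantorMaximal.nearTubes n c) ^ (1 / p.toReal) ≤
      eLpNorm (CantorMaximal.maximalOperator f) p volume := by
    have h := eLpNorm_indicator_const (μ := volume) (c := (3⁻¹ : ℝ≥0∞))
      (CantorMaximal.measurableSet_nearTubes n c) hp_pos hp_fin
    rw [enorm_eq_self] at h
    rw [← h]
    refine eLpNorm_mono_enorm fun z => ?_
    by_cases hz : z ∈ CantorMaximal.nearTubes n c
    · simpa [hz] using CantorMaximal.le_maximalOperator (fun z hz => hf1 hz) hz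
    · simp [hz]
  have hup : eLpNorm f p volume ≤ volume U ^ (1 / p.toReal) := by
    have h := eLpNorm_indicator_const (μ := volume) (c := (1 : ℝ)) hU.measurableSet hp_pos hp_fin
    rw [enorm_one, one_mul] at h
    rw [← h]
    refine eLpNorm_mono_enorm fun z => ?_
    by_cases hz : z ∈ U
    · simpa [hz, Real.enorm_of_nonneg (hf01 z).1] using (hf01 z).2
    · simp [hz, hf0 hz]
  have hroot : volume (CantorMaximal.nearTubes n c) ^ (1 / p.toReal) ≤
      (3 * C : ℝ≥0) * volume U ^ (1 / p.toReal) := by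
    have h := hlow.trans ((hC f f.continuous hfc).trans (mul_le_mul_right hup (C : ℝ≥0∞)))
    rw [ENNReal.inv_mul_le_iff (by norm_num) (by norm_num)] at h
    simpa [mul_assoc] using h
  refine absurd (ENNReal.rpow_le_rpow hroot hp.le) (not_le.2 ?_)
  rw [ENNReal.mul_rpow_of_nonneg _ _ hp.le, ← ENNReal.rpow_mul, ← ENNReal.rpow_mul,
    one_div_mul_cancel hp.ne', ENNReal.rpow_one, ENNReal.rpow_one,
    ← ENNReal.coe_rpow_of_nonneg _ hp.le]
  exact hlt
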